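/- Fix $m\ge 0$. For each integer $N\ge 1$ let $(A_N,\psi^{(N)})$ be a noncommutative probability space (a unital complex algebra with a linear functional satisfying $\psi^{(N)}(1)=1$) containing a free semicircular family $\{s(i,j,k): 1\le i\le j\le N,\ 1\le k\le m\}$, i.e. freely independent elements, each distributed according to the semicircle law $\gamma$ of density $\frac1{2\pi}\sqrt{4-x^2}$ on $[-2,2]$. Let $X_N(k)$ be the symmetric $N\times N$ matrix over $A_N$ whose $(i,j)$ and $(j,i)$ entries, for $i\le j$, are both equal to $\sqrt{(1+\delta_{ij})/N}\; s(i,j,k)$, so that these entries have variance $(1+\delta_{ij})/N$. Put $\psi_N=\frac1N\mathrm{Tr}\otimes\psi^{(N)}$ on $M_N(A_N)$. Then for every noncommutative polynomial $p\in\mathbb C\langle t_1,\dots,t_m\rangle$ the limits $$\mu(p)=\lim_{N\to\infty}\psi_N\big(p(X_N(1),\dots,X_N(m))\big),\qquad \mu'(p)=\lim_{N\to\infty}\frac{\psi_N\big(p(X_N(1),\dots,X_N(m))\big)-\mu(p)}{1/N}$$ exist, and $(\mu,\mu')$ is an infinitesimal law: $\mu,\mu'$ are linear, $\mu(1)=1$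 and $\mu'(1)=0$. Moreover: (a) the variables $t_1,\dots,t_m$ are infinitesimally free with respect to $(\mu,\mu')$: with $\mu_t=\mu+t\mu'$ for $t\in\mathbb R$, for all $n\ge1$, all indices $k_1,\dots,k_n\in\{1,\dots,m\}$ with $k_1\ne k_2\ne\cdots\ne k_n$ (consecutive indices distinct) and all polynomials $p_j\in\mathbb C[t_{k_j}]$, $$\mu_t\big((p_1-\mu_t(p_1))\cdots(p_n-\mu_t(p_n))\big)=o(t)\quad\text{as } t\to0;$$ (b) for each $k$, the restriction of $(\mu,\mu')$ to the variable $t_k$ is the infinitesimal (type B) semicircular law: for all $n\ge0$, $\mu(t_k^n)=\int x^n\,d\gamma(x)$ and $\mu'(t_k^n)=\int x^n\,d\alpha(x)-\int x^n\,d\gamma(x)$, where $\alpha$ is the arcsine law of density $\frac1{\pi\sqrt{4-x^2}}$ on $(-2,2)$. -/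

import Mathlib

open Filter Topology MeasureTheory Asymptotics

noncomputable section

namespace InfFree

/-! ### Freeness in a noncommutative probability space

A noncommutative probability space is a unital complex algebra `A` with a linear functional
`φ : A →ₗ[ℂ] ℂ` such that `φ 1 = 1`. -/

/-- Unital subalgebras `S i` are freely independent with respect to `φ`: `φ (a₁ ⋯ aₙ) = 0`
whenever `n ≥ 1`, `aⱼ ∈ S (iⱼ)`, `φ aⱼ = 0` and consecutive indices `iⱼ` are distinct. The word
`a₁ ⋯ aₙ` together with its indices is given as a list of pairs `(iⱼ, aⱼ)`. -/
def FreelyIndependent {A : Type*} [Ring A] [Algebra ℂ A] (φ : A →ₗ[ℂ] ℂ) {ι : Type*}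
    (S : ι → Subalgebra ℂ A) : Prop :=
  ∀ w : List (ι × A), w ≠ [] →
    (∀ x ∈ w, x.2 ∈ S x.1) →
    (∀ x ∈ w, φ x.2 = 0) →
    w.IsChain (fun x y => x.1 ≠ y.1) →
    φ (w.map Prod.snd).prod = 0

/-- The (standard) semicircle law on `ℝ`, with density `√(4 - x²) / (2π)` on `[-2, 2]`.
(Outside this interval the real square root vanishes.) -/
def semicircleLaw : Measure ℝ :=
  volume.withDensity (fun x => ENNReal.ofReal (√(4 - x ^ 2) / (2 * Real.pi)))

/-- The arcsine law on `(-2, 2)`, with density `1 / (π √(4 - x²))`. (Outside this interval the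
real square root vanishes, and so does the quotient.) -/
def arcsineLaw : Measure ℝ :=
  volume.withDensity (fun x => ENNReal.ofReal (1 / (Real.pi * √(4 - x ^ 2))))

/-- The `n`-th moment of a measure on the line, as a complex number. -/
def moment (ν : Measure ℝ) (n : ℕ) : ℂ := ((∫ x, x ^ n ∂ν : ℝ) : ℂ)

/-- `a` is a (standard) semicircular variable: its law is the semicircle law of variance `1`. -/
def IsSemicircularVar {A : Type*} [Ring A] [Algebra ℂ A] (φ : A →ₗ[ℂ] ℂ) (a : A) : Prop :=
  ∀ n : ℕ, φ (a ^ n) = moment semicircleLaw n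

/-- A free semicircular family: freely independent standard semicircular variables. -/
structure IsFreeSemicircularFamily {A : Type*} [Ring A] [Algebra ℂ A] (φ : A →ₗ[ℂ] ℂ)
    {ι : Type*} (s : ι → A) : Prop where
  semicircular : ∀ i, IsSemicircularVar φ (s i)
  free : FreelyIndependent φ (fun i => Algebra.adjoin ℂ {s i})

/-! ### Infinitesimal laws -/

/-- An infinitesimal law of the variables `t i`, `i : ι`: a pair of linear functionals on the
algebra of noncommutative polynomials, the first with value `1` and the second with value `0`
at the constant polynomial `1`. -/
structure InfinitesimalLaw (ι : Type*) where
  zeroth : FreeAlgebra ℂ ι →ₗ[ℂ] ℂ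
  first : FreeAlgebra ℂ ι →ₗ[ℂ] ℂ
  zeroth_one : zeroth 1 = 1
  first_one : first 1 = 0

namespace InfinitesimalLaw

variable {ι : Type*}

/-- The family of laws `μ + t μ'`. -/
def lawAt (L : InfinitesimalLaw ι) (t : ℝ) : FreeAlgebra ℂ ι →ₗ[ℂ] ℂ :=
  L.zeroth + (t : ℂ) • L.first

/-- The restriction of an infinitesimal law to the single variable `t k`. -/
def restrict (L : InfinitesimalLaw ι) (k : ι) : InfinitesimalLaw Unit where
  zeroth := L.zeroth ∘ₗ
    (FreeAlgebra.lift ℂ (fun _ : Unit => FreeAlgebra.ι ℂ k)).toLinearMap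
  first := L.first ∘ₗ
    (FreeAlgebra.lift ℂ (fun _ : Unit => FreeAlgebra.ι ℂ k)).toLinearMap
  zeroth_one := by simp [L.zeroth_one]
  first_one := by simp [L.first_one]

/-- Subalgebras `S k` of the noncommutative polynomials are infinitesimally free: they are free
to order `t` with respect to the laws `μ + t μ'`, that is, if `p₁, …, pₙ` (with `n ≥ 1`) lie
in `S (k₁), …, S (kₙ)`, consecutive indices being distinct, then
`(μ + t μ') ((p₁ - (μ + t μ') p₁) ⋯ (pₙ - (μ + t μ') pₙ)) = o(t)` as `t → 0`. -/
def InfinitesimallyFree (L : InfinitesimalLaw ι) {κ : Type*}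
    (S : κ → Subalgebra ℂ (FreeAlgebra ℂ ι)) : Prop :=
  ∀ w : List (κ × FreeAlgebra ℂ ι), w ≠ [] →
    (∀ x ∈ w, x.2 ∈ S x.1) →
    w.IsChain (fun x y => x.1 ≠ y.1) →
    (fun t : ℝ =>
      L.lawAt t (w.map fun x =>
        x.2 - algebraMap ℂ (FreeAlgebra ℂ ι) (L.lawAt t x.2)).prod)
      =o[𝓝[≠] 0] (fun t : ℝ => t)

/-- The variables `t k` themselves are infinitesimally free. -/
def VariablesInfinitesimallyFree (L : InfinitesimalLaw ι) : Prop :=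
  L.InfinitesimallyFree (fun k : ι => Algebra.adjoin ℂ {FreeAlgebra.ι ℂ k})

/-- The infinitesimal (type B) semicircular law of one variable: `μ` is given by the semicircle
law, and `μ'` by the difference of the arcsine law and the semicircle law. -/
def IsSemicircular (L : InfinitesimalLaw Unit) : Prop :=
  ∀ n : ℕ,
    L.zeroth (FreeAlgebra.ι ℂ () ^ n) = moment semicircleLaw n ∧
    L.first (FreeAlgebra.ι ℂ () ^ n) = moment arcsineLaw n - moment semicircleLaw n

/-- `L = (μ, μ')` is the infinitesimal law, as `1/N → 0`, of a sequence of laws `φ N`: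
`μ p = lim φ N p` and `μ' p = lim (φ N p - μ p) / (1/N)`, both limits existing for all `p`. -/
def IsInfinitesimalLimit (L : InfinitesimalLaw ι) (φ : ℕ → FreeAlgebra ℂ ι →ₗ[ℂ] ℂ) : Prop :=
  ∀ p : FreeAlgebra ℂ ι,
    Tendsto (fun N => φ N p) atTop (𝓝 (L.zeroth p)) ∧
    Tendsto (fun N : ℕ => (φ N p - L.zeroth p) / (1 / (N : ℂ))) atTop (𝓝 (L.first p))

end InfinitesimalLaw

/-! ### The matrix model -/

/-- The functional `(1/N) Tr ⊗ φ` on `N × N` matrices over `A`. -/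
def matrixFunctional {A : Type*} [Ring A] [Algebra ℂ A] (φ : A →ₗ[ℂ] ℂ) (N : ℕ) :
    Matrix (Fin N) (Fin N) A →ₗ[ℂ] ℂ :=
  (1 / (N : ℂ)) • (φ ∘ₗ Matrix.traceLinearMap (Fin N) ℂ A)

/-- The joint law, with respect to `φ`, of variables `x k`, `k : ι`. -/
def jointLaw {A : Type*} [Ring A] [Algebra ℂ A] (φ : A →ₗ[ℂ] ℂ) {ι : Type*} (x : ι → A) :
    FreeAlgebra ℂ ι →ₗ[ℂ] ℂ :=
  φ ∘ₗ (FreeAlgebra.lift ℂ x).toLinearMap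

/-- The index set `{(i, j, k) : i ≤ j}` of the semicircular variables in `m` matrices of
size `N`. -/
abbrev EntryIndex (N m : ℕ) : Type :=
  {e : Fin N × Fin N × Fin m // e.1 ≤ e.2.1}

/-- The symmetric matrix `X_N(k)`: for `i ≤ j` its entries at `(i, j)` and `(j, i)` are both
`√((1 + δ_{ij}) / N) • s(i, j, k)`, a variable of variance `(1 + δ_{ij}) / N`. -/
def semicircularMatrix {A : Type*} [Ring A] [Algebra ℂ A] {N m : ℕ} (s : EntryIndex N m → A)
    (k : Fin m) : Matrix (Fin N) (Fin N) A :=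
  Matrix.of fun i j =>
    ((√((1 + if i = j then 1 else 0) / (N : ℝ)) : ℝ) : ℂ) •
      s ⟨(min i j, max i j, k), min_le_max⟩

end InfFree

end

/-! For each fixed `N ≥ 1` the model can be solved exactly: `X_N(1), …, X_N(m)` have the law of free
semicircular variables of variance `1 + 1/N`. To see this, realise the entries as creation plus
annihilation operators on a full Fock space. The matrix of creation operators and the matrix of
annihilation operators then satisfy `b_k a_l = δ_{kl} (1 + 1/N)`. The normalised trace tensored with
the vacuum state kills `a_k Y` and `Y b_k`. These relations determine the law
(`isWickLaw_of_creation_annihilation`), because products of Chebyshev polynomials, the Wick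
polynomials, span all noncommutative polynomials. The same polynomials show that any abstract free
semicircular family has the Fock space law (`IsFreeSemicircularFamily.jointLaw_eq`).

The limits are therefore the value and the derivative at `t = 0` of the law of variance `1 + t`.
That law is obtained by scaling variables by `√(1 + t)`, so the derivative multiplies a monomial of
degree `n` by `n/2`. Infinitesimal freeness follows because `μ + tμ'` agrees to order `o(t)` with a
law that is exactly free. The law of one variable follows from the moment identity `α_n = (n/2 + 1)
γ_n` between the arcsine and semicircle laws (`moment_arcsineLaw`). -/

noncomputable section

namespace InfFree

open Polynomial.Chebyshev (S S_add_two)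

/-! ### Wick polynomials -/

section Wick

variable {ι : Type*} [DecidableEq ι]

/-- The noncommutative Wick polynomials: products of Chebyshev polynomials of the second kind. -/
def wick : List ι → FreeAlgebra ℂ ι
  | [] => 1
  | [i] => FreeAlgebra.ι ℂ i
  | i :: j :: v => FreeAlgebra.ι ℂ i * wick (j :: v) - if i = j then wick v else 0

/-- The contraction of a letter with the first letter of a word. -/
def wickContract (i : ι) : List ι → FreeAlgebra ℂ ι
  | [] => 0
  | j :: v => if i = j then wick v else 0

theorem ι_mul_wick (i : ι) (v : List ι) :
    FreeAlgebra.ι ℂ i * wick v = wick (i :: v) + wickContract i v := by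
  cases v <;> simp [wick, wickContract]

/-- By `ι_mul_wick`, multiplying a Wick polynomial on the left by a variable gives a combination of
Wick polynomials. The span is thus a left ideal, and it contains `1`. -/
theorem span_wick : Submodule.span ℂ (Set.range (wick (ι := ι))) = ⊤ := by
  set K := Submodule.span ℂ (Set.range (wick (ι := ι))) with hK
  have hw : ∀ v, wick v ∈ K := fun v => Submodule.subset_span ⟨v, rfl⟩
  have key : ∀ p : FreeAlgebra ℂ ι, ∀ q ∈ K, p * q ∈ K := by
    intro p
    induction p using FreeAlgebra.induction with
    | grade0 r =>
      intro q hq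
      rw [← Algebra.smul_def]
      exact K.smul_mem r hq
    | grade1 i =>
      intro q hq
      induction hq using Submodule.span_induction with
      | mem x hx =>
        obtain ⟨v, rfl⟩ := hx
        rw [ι_mul_wick]
        refine K.add_mem (hw _) ?_
        cases v with
        | nil => exact K.zero_mem
        | cons j v =>
          rw [wickContract]
          split_ifs
          exacts [hw v, K.zero_mem]
      | zero => simp
      | add x y _ _ hx hy => rw [mul_add]; exact K.add_mem hx hy
      | smul c x _ hx => rw [mul_smul_comm]; exact K.smul_mem c hx
    | mul p q hp hq =>
      intro r hr
      rw [mul_assoc]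
      exact hp _ (hq _ hr)
    | add p q hp hq =>
      intro r hr
      rw [add_mul]
      exact K.add_mem (hp _ hr) (hq _ hr)
  refine eq_top_iff.2 fun p _ => ?_
  simpa using key p 1 (hw [])

/-- The law of a free standard semicircular family, described by its values at the Wick
polynomials. -/
def IsWickLaw (J : FreeAlgebra ℂ ι →ₗ[ℂ] ℂ) : Prop :=
  ∀ v, J (wick v) = if v = [] then 1 else 0

theorem IsWickLaw.eq {J J' : FreeAlgebra ℂ ι →ₗ[ℂ] ℂ} (h : IsWickLaw J) (h' : IsWickLaw J') :
    J = J' := by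
  refine LinearMap.ext_on span_wick ?_
  rintro _ ⟨v, rfl⟩
  rw [h, h']

theorem IsWickLaw.map_one {J : FreeAlgebra ℂ ι →ₗ[ℂ] ℂ} (h : IsWickLaw J) : J 1 = 1 := by
  simpa [wick] using h []

/-! ### Creation and annihilation -/

/-- The normally ordered product of the variables `a i + b i` along a word. -/
def normalOrdered {B : Type*} [Semiring B] (a b : ι → B) : List ι → B
  | [] => 1
  | i :: v => a i * normalOrdered a b v + ((i :: v).map b).prod

/-- The correction term in the recursion for `wick` is exactly the contraction `b i * a j` that
appears when `b i` meets a leading creation operator, so every surviving term has its `a`'s to the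
left of its `b`'s. -/
theorem lift_wick {B : Type*} [Ring B] [Algebra ℂ B] {a b : ι → B}
    (h : ∀ i j, b i * a j = if i = j then 1 else 0) :
    ∀ v : List ι, FreeAlgebra.lift ℂ (a + b) (wick v) = normalOrdered a b v
  | [] => by simp [wick, normalOrdered]
  | [i] => by simp [wick, normalOrdered]
  | i :: j :: v => by
    rw [wick, map_sub, map_mul, lift_wick h (j :: v), FreeAlgebra.lift_ι_apply]
    have e : FreeAlgebra.lift ℂ (a + b) (if i = j then wick v else 0)
        = if i = j then normalOrdered a b v else 0 := by
      rw [apply_ite (FreeAlgebra.lift ℂ (a + b)), lift_wick h v, map_zero]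
    rw [e, normalOrdered, normalOrdered, Pi.add_apply, add_mul, mul_add (b i), ← mul_assoc (b i),
      h i j, ite_mul, one_mul, zero_mul, normalOrdered, List.map_cons (a := i), List.prod_cons]
    abel

/-- For a nonempty word, the normally ordered product is a term beginning with some `a i` plus a
term ending with some `b i`, and `φ` kills both. The argument needs no Hilbert space or adjoint, so
it serves the Fock space and the matrices over it alike. -/
theorem isWickLaw_of_creation_annihilation {B : Type*} [Ring B] [Algebra ℂ B] {a b : ι → B}
    (h : ∀ i j, b i * a j = if i = j then 1 else 0) (φ : B →ₗ[ℂ] ℂ) (h1 : φ 1 = 1)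
    (ha : ∀ i y, φ (a i * y) = 0) (hb : ∀ i y, φ (y * b i) = 0) :
    IsWickLaw (jointLaw φ (a + b)) := by
  intro v
  rw [jointLaw, LinearMap.comp_apply, AlgHom.toLinearMap_apply, lift_wick h]
  cases v with
  | nil => simpa [normalOrdered] using h1
  | cons i v =>
    rw [normalOrdered, map_add, ha, zero_add, if_neg (List.cons_ne_nil _ _),
      ← List.dropLast_append_getLast (List.cons_ne_nil i v), List.map_append, List.prod_append,
      List.map_singleton, List.prod_singleton, hb]

end Wick

/-! ### The full Fock space -/

section Fock

/-- The algebraic full Fock space over the vector space with basis `ι`. -/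
abbrev Fock (ι : Type*) : Type _ := List ι →₀ ℂ

variable {ι : Type*}

/-- The left creation operator. -/
def creation (i : ι) : Module.End ℂ (Fock ι) := Finsupp.lmapDomain ℂ ℂ (List.cons i)

/-- The left annihilation operator. -/
def annihilation (i : ι) : Module.End ℂ (Fock ι) :=
  Finsupp.lcomapDomain (List.cons i) List.cons_injective

/-- The vacuum state. -/
def vacuumState (ι : Type*) : Module.End ℂ (Fock ι) →ₗ[ℂ] ℂ :=
  Finsupp.lapply [] ∘ₗ LinearMap.applyₗ (Finsupp.single ([] : List ι) (1 : ℂ))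

theorem vacuumState_apply (T : Module.End ℂ (Fock ι)) :
    vacuumState ι T = T (Finsupp.single [] 1) [] := rfl

theorem creation_apply_nil (i : ι) (f : Fock ι) : creation i f [] = 0 :=
  Finsupp.mapDomain_of_notMem_range _ _ (by simp)

theorem annihilation_vacuum (i : ι) (c : ℂ) :
    annihilation i (Finsupp.single [] c) = 0 := by
  ext v
  simp [annihilation, Finsupp.lcomapDomain]

theorem annihilation_mul_creation [DecidableEq ι] (i j : ι) :
    annihilation i * creation j = if i = j then 1 else 0 := by
  refine LinearMap.ext fun f => Finsupp.ext fun v => ?_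
  change (Finsupp.mapDomain (List.cons j) f) (i :: v) = _
  split_ifs with hij
  · subst hij
    exact Finsupp.mapDomain_apply List.cons_injective _ _
  · refine (Finsupp.mapDomain_of_notMem_range _ _ ?_).trans rfl
    rintro ⟨w, hw⟩
    exact hij (List.cons.inj hw).1.symm

theorem vacuumState_one : vacuumState ι 1 = 1 := by simp [vacuumState_apply]

theorem vacuumState_creation_mul (i : ι) (T : Module.End ℂ (Fock ι)) :
    vacuumState ι (creation i * T) = 0 := creation_apply_nil i _

theorem vacuumState_mul_annihilation (i : ι) (T : Module.End ℂ (Fock ι)) :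
    vacuumState ι (T * annihilation i) = 0 := by
  rw [vacuumState_apply, Module.End.mul_apply, annihilation_vacuum, map_zero, Finsupp.zero_apply]

/-- The law of a free standard semicircular family. -/
def freeSemicircularLaw (ι : Type*) : FreeAlgebra ℂ ι →ₗ[ℂ] ℂ :=
  jointLaw (vacuumState ι) (creation + annihilation)

theorem isWickLaw_freeSemicircularLaw [DecidableEq ι] : IsWickLaw (freeSemicircularLaw ι) :=
  isWickLaw_of_creation_annihilation annihilation_mul_creation _ vacuumState_one
    vacuumState_creation_mul vacuumState_mul_annihilation

end Fock

/-! ### Freeness and the Wick polynomials -/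

section Freeness

theorem freelyIndependent_jointLaw {ι A : Type*} [Ring A] [Algebra ℂ A] {φ : A →ₗ[ℂ] ℂ}
    {s : ι → A} (hf : FreelyIndependent φ (fun i => Algebra.adjoin ℂ {s i})) :
    FreelyIndependent (jointLaw φ s) (fun i : ι => Algebra.adjoin ℂ {FreeAlgebra.ι ℂ i}) := by
  intro w hw hm h0 hc
  have hf' := hf (w.map fun x => (x.1, FreeAlgebra.lift ℂ s x.2)) (by simpa using hw) ?_ ?_ ?_
  · rw [jointLaw, LinearMap.comp_apply, AlgHom.toLinearMap_apply, map_list_prod]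
    simpa [List.map_map, Function.comp_def] using hf'
  · intro x hx
    obtain ⟨y, hy, rfl⟩ := List.mem_map.1 hx
    have := Subalgebra.mem_map.2 ⟨_, hm y hy, (rfl : FreeAlgebra.lift ℂ s y.2 = _)⟩
    simpa [AlgHom.map_adjoin] using this
  · intro x hx
    obtain ⟨y, hy, rfl⟩ := List.mem_map.1 hx
    exact h0 y hy
  · rw [List.isChain_map]
    exact hc

theorem span_chebyshev_S :
    Submodule.span ℂ (Set.range fun k : ℕ => S ℂ k) = ⊤ := by
  set K := Submodule.span ℂ (Set.range fun k : ℕ => S ℂ k) with hK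
  have hS : ∀ k : ℕ, S ℂ k ∈ K := fun k => Submodule.subset_span ⟨k, rfl⟩
  have hX : ∀ q ∈ K, Polynomial.X * q ∈ K := by
    intro q hq
    induction hq using Submodule.span_induction with
    | mem x hx =>
      obtain ⟨k, rfl⟩ := hx
      cases k with
      | zero => simpa using hS 1
      | succ k =>
        have h2 := S_add_two ℂ (k : ℤ)
        have : Polynomial.X * S ℂ ((k + 1 : ℕ) : ℤ) = S ℂ ((k + 2 : ℕ) : ℤ) + S ℂ (k : ℤ) := by
          push_cast
          rw [h2]; ring
        change Polynomial.X * S ℂ ((k + 1 : ℕ) : ℤ) ∈ K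
        rw [this]
        exact K.add_mem (hS _) (hS _)
    | zero => simp
    | add x y _ _ hx hy => rw [mul_add]; exact K.add_mem hx hy
    | smul c x _ hx => rw [mul_smul_comm]; exact K.smul_mem c hx
  have hpow : ∀ n : ℕ, (Polynomial.X : Polynomial ℂ) ^ n ∈ K := by
    intro n
    induction n with
    | zero => simpa using hS 0
    | succ n ih => rw [pow_succ']; exact hX _ ih
  refine eq_top_iff.2 fun p _ => ?_
  rw [p.as_sum_range_C_mul_X_pow]
  refine K.sum_mem fun n _ => ?_
  rw [← Polynomial.smul_eq_C_mul]
  exact K.smul_mem _ (hpow n)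

variable {ι : Type*} [DecidableEq ι]

/-- Contractions happen only between equal neighbours, so they never cross the end of a maximal
block of equal letters. Within a block the recursion is that of the Chebyshev polynomials `S`. -/
theorem wick_replicate_append (i : ι) (v : List ι) (hv : v.head? ≠ some i) :
    ∀ k : ℕ, wick (List.replicate k i ++ v)
      = Polynomial.aeval (FreeAlgebra.ι ℂ i) (S ℂ k) * wick v
  | 0 => by simp
  | 1 => by
    cases v with
    | nil => simp [wick]
    | cons j v =>
      have : i ≠ j := fun h => hv (by simp [h])
      simp [wick, this]
  | k + 2 => by
    have h1 := wick_replicate_append i v hv (k + 1)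
    have h0 := wick_replicate_append i v hv k
    rw [List.replicate_succ, List.cons_append] at h1
    rw [List.replicate_succ, List.replicate_succ, List.cons_append, List.cons_append, wick,
      if_pos rfl, h1, h0]
    push_cast
    rw [S_add_two, map_sub, map_mul, Polynomial.aeval_X, sub_mul, mul_assoc]

theorem wick_replicate (i : ι) (k : ℕ) :
    wick (List.replicate k i) = Polynomial.aeval (FreeAlgebra.ι ℂ i) (S ℂ k) := by
  simpa [wick] using wick_replicate_append i [] (by simp) k

/-- All `S k` with `k ≥ 1` are centred, so subtracting the mean removes precisely the component
along `S 0 = 1`. -/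
theorem IsWickLaw.mem_span_of_centered {J : FreeAlgebra ℂ ι →ₗ[ℂ] ℂ} (h : IsWickLaw J) {i : ι}
    {p : FreeAlgebra ℂ ι} (hp : p ∈ Algebra.adjoin ℂ {FreeAlgebra.ι ℂ i}) (h0 : J p = 0) :
    p ∈ Submodule.span ℂ
      (Set.range fun k : ℕ => Polynomial.aeval (FreeAlgebra.ι ℂ i) (S ℂ (k + 1 : ℕ))) := by
  set K := Submodule.span ℂ
    (Set.range fun k : ℕ => Polynomial.aeval (FreeAlgebra.ι ℂ i) (S ℂ (k + 1 : ℕ)))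
  have key : ∀ q ∈ Submodule.span ℂ (Set.range fun k : ℕ => S ℂ k),
      Polynomial.aeval (FreeAlgebra.ι ℂ i) q
        - J (Polynomial.aeval (FreeAlgebra.ι ℂ i) q) • 1 ∈ K := by
    intro q hq
    induction hq using Submodule.span_induction with
    | mem x hx =>
      obtain ⟨k, rfl⟩ := hx
      cases k with
      | zero => simp [h.map_one]
      | succ k =>
        have e : J (Polynomial.aeval (FreeAlgebra.ι ℂ i) (S ℂ ((k + 1 : ℕ) : ℤ))) = 0 := by
          rw [← wick_replicate, h, if_neg (by simp)]
        simp only [e, zero_smul, sub_zero]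
        exact Submodule.subset_span ⟨k, rfl⟩
    | zero => simp
    | add x y _ _ hx hy =>
      simp only [map_add, add_smul]
      rw [add_sub_add_comm]
      exact K.add_mem hx hy
    | smul c x _ hx =>
      simp only [map_smul, smul_eq_mul, mul_smul]
      rw [← smul_sub]
      exact K.smul_mem c hx
  rw [Algebra.adjoin_singleton_eq_range_aeval] at hp
  obtain ⟨q, rfl⟩ := hp
  have := key q (by rw [span_chebyshev_S]; trivial)
  simpa [show J (Polynomial.aeval (FreeAlgebra.ι ℂ i) q) = 0 from h0] using this

/-- The span of the Wick polynomials of the words whose first letter satisfies `P`. -/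
def wickSpan (P : Option ι → Prop) : Submodule ℂ (FreeAlgebra ℂ ι) :=
  Submodule.span ℂ (wick '' {v | P v.head?})

theorem IsWickLaw.mul_mem_wickSpan {J : FreeAlgebra ℂ ι →ₗ[ℂ] ℂ} (h : IsWickLaw J) {i : ι}
    {p q : FreeAlgebra ℂ ι} (hp : p ∈ Algebra.adjoin ℂ {FreeAlgebra.ι ℂ i}) (h0 : J p = 0)
    (hq : q ∈ wickSpan (· ≠ some i)) : p * q ∈ wickSpan (· = some i) := by
  have hmul := Submodule.mul_mem_mul (h.mem_span_of_centered hp h0) hq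
  rw [wickSpan, Submodule.span_mul_span] at hmul
  refine Submodule.span_mono ?_ hmul
  rintro _ ⟨_, ⟨k, rfl⟩, _, ⟨v, hv, rfl⟩, rfl⟩
  exact ⟨List.replicate (k + 1) i ++ v, by simp [List.replicate_succ],
    wick_replicate_append i v hv (k + 1)⟩

/-- Each centred factor prepends nonempty blocks of its own letter. Since consecutive indices
differ, these blocks never merge, and the first letter is remembered to carry the induction. -/
theorem IsWickLaw.prod_mem_wickSpan {J : FreeAlgebra ℂ ι →ₗ[ℂ] ℂ} (h : IsWickLaw J) :
    ∀ w : List (ι × FreeAlgebra ℂ ι),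
      (∀ x ∈ w, x.2 ∈ Algebra.adjoin ℂ {FreeAlgebra.ι ℂ x.1}) → (∀ x ∈ w, J x.2 = 0) →
      w.IsChain (fun x y => x.1 ≠ y.1) →
      (w.map Prod.snd).prod ∈ wickSpan (· = w.head?.map Prod.fst)
  | [], _, _, _ => Submodule.subset_span ⟨[], rfl, rfl⟩
  | (i, p) :: w, hm, h0, hc => by
    have ih := h.prod_mem_wickSpan w (fun x hx => hm x (List.mem_cons_of_mem _ hx))
      (fun x hx => h0 x (List.mem_cons_of_mem _ hx)) hc.tail
    rw [List.map_cons, List.prod_cons]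
    refine h.mul_mem_wickSpan (hm _ List.mem_cons_self) (h0 _ List.mem_cons_self)
      (Submodule.span_mono (Set.image_mono ?_) ih)
    intro v hv
    cases w with
    | nil => simp_all
    | cons x w =>
      have := (List.isChain_cons_cons.1 hc).1
      simp only [List.head?_cons, Option.map_some, Set.mem_ofPred_eq] at hv ⊢
      rw [hv]
      exact fun e => this (Option.some.inj e).symm

theorem IsWickLaw.freelyIndependent {J : FreeAlgebra ℂ ι →ₗ[ℂ] ℂ} (h : IsWickLaw J) :
    FreelyIndependent J (fun i : ι => Algebra.adjoin ℂ {FreeAlgebra.ι ℂ i}) := by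
  intro w hw hm h0 hc
  have hs : wickSpan (· = w.head?.map Prod.fst) ≤ LinearMap.ker J := by
    refine Submodule.span_le.2 ?_
    rintro _ ⟨v, hv, rfl⟩
    have : v ≠ [] := by
      rintro rfl
      cases w <;> simp_all
    simp [h v, this]
  exact hs (h.prod_mem_wickSpan w hm h0 hc)

theorem exists_replicate_append (i : ι) :
    ∀ v : List ι, ∃ (k : ℕ) (u : List ι), v = List.replicate k i ++ u ∧ u.head? ≠ some i
  | [] => ⟨0, [], by simp⟩
  | j :: v => by
    by_cases hij : j = i
    · obtain ⟨k, u, hv, hu⟩ := exists_replicate_append i v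
      exact ⟨k + 1, u, by simp [List.replicate_succ, hij, hv], hu⟩
    · exact ⟨0, j :: v, by simp [hij]⟩

/-- Cutting a word into maximal constant blocks factors its Wick polynomial into an alternating
product of centred Chebyshev polynomials. Freeness can then be applied to it directly. -/
theorem exists_alternating_eq_wick {J : FreeAlgebra ℂ ι →ₗ[ℂ] ℂ}
    (hJ : ∀ (i : ι) (k : ℕ), J (Polynomial.aeval (FreeAlgebra.ι ℂ i) (S ℂ (k + 1 : ℕ))) = 0)
    (v : List ι) : ∃ w : List (ι × FreeAlgebra ℂ ι),
      (∀ x ∈ w, x.2 ∈ Algebra.adjoin ℂ {FreeAlgebra.ι ℂ x.1}) ∧ (∀ x ∈ w, J x.2 = 0) ∧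
      w.IsChain (fun x y => x.1 ≠ y.1) ∧ (w.map Prod.snd).prod = wick v ∧
      w.head?.map Prod.fst = v.head? := by
  induction hn : v.length using Nat.strong_induction_on generalizing v with
  | _ n ih =>
    subst hn
    cases v with
    | nil => exact ⟨[], by simp [wick]⟩
    | cons i v =>
      obtain ⟨k, u, rfl, hu⟩ := exists_replicate_append i v
      obtain ⟨w, hm, h0, hc, hp, hh⟩ := ih u.length (by simp) u rfl
      refine ⟨(i, Polynomial.aeval (FreeAlgebra.ι ℂ i) (S ℂ (k + 1 : ℕ))) :: w, ?_, ?_, ?_, ?_,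
        by simp⟩
      · rintro x (_ | ⟨_, hx⟩)
        · exact Polynomial.aeval_mem_adjoin_singleton _ _
        · exact hm x hx
      · rintro x (_ | ⟨_, hx⟩)
        · exact hJ i k
        · exact h0 x hx
      · rw [List.isChain_cons]
        refine ⟨fun y hy e => hu ?_, hc⟩
        rw [← hh, Option.mem_def.1 hy, Option.map_some, ← e]
      · rw [List.map_cons, List.prod_cons, hp, ← wick_replicate_append i u hu,
          List.replicate_succ, List.cons_append]

theorem FreelyIndependent.isWickLaw {J : FreeAlgebra ℂ ι →ₗ[ℂ] ℂ}
    (hf : FreelyIndependent J (fun i : ι => Algebra.adjoin ℂ {FreeAlgebra.ι ℂ i})) (h1 : J 1 = 1)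
    (hJ : ∀ (i : ι) (k : ℕ), J (Polynomial.aeval (FreeAlgebra.ι ℂ i) (S ℂ (k + 1 : ℕ))) = 0) :
    IsWickLaw J := by
  intro v
  split_ifs with hv
  · simpa [hv, wick] using h1
  · obtain ⟨w, hm, h0, hc, hp, hh⟩ := exists_alternating_eq_wick hJ v
    rw [← hp]
    refine hf w ?_ hm h0 hc
    rintro rfl
    cases v <;> simp_all

end Freeness

/-! ### Moments of the semicircle and arcsine laws -/

section Moments

theorem integral_arcsineLaw (f : ℝ → ℝ) :
    ∫ x, f x ∂arcsineLaw = (1 / Real.pi) * ∫ θ in (0 : ℝ)..Real.pi, f (2 * Real.cos θ) := by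
  have hsub : ∀ y : ℝ, √(4 - (2 * y) ^ 2) = 2 * √(1 - y ^ 2) := fun y => by
    rw [show 4 - (2 * y) ^ 2 = 2 ^ 2 * (1 - y ^ 2) by ring, Real.sqrt_mul (by norm_num),
      Real.sqrt_sq (by norm_num)]
  have h1 : ∫ x, f x ∂arcsineLaw = ∫ x, 1 / (Real.pi * √(4 - x ^ 2)) * f x := by
    rw [arcsineLaw, integral_withDensity_eq_integral_toReal_smul (by fun_prop)
      (ae_of_all _ fun _ => ENNReal.ofReal_lt_top)]
    refine integral_congr_ae (ae_of_all _ fun x => ?_)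
    simp only [smul_eq_mul]
    rw [ENNReal.toReal_ofReal (by positivity)]
  have h2 := Measure.integral_comp_mul_left (fun x => 1 / (Real.pi * √(4 - x ^ 2)) * f x) 2
  have h3 : ∫ y in Set.Ioc (-1 : ℝ) 1, 1 / (Real.pi * √(4 - (2 * y) ^ 2)) * f (2 * y)
      = ∫ y : ℝ, 1 / (Real.pi * √(4 - (2 * y) ^ 2)) * f (2 * y) := by
    refine setIntegral_eq_integral_of_forall_compl_eq_zero fun y hy => ?_
    -- Outside the interval the real square root is `0`, and division by zero makes the density
    -- vanish.
    have : √(1 - y ^ 2) = 0 := by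
      refine Real.sqrt_eq_zero_of_nonpos ?_
      rw [Set.mem_Ioc, not_and_or, not_lt, not_le] at hy
      rcases hy with hy | hy <;> nlinarith
    rw [hsub, this]
    simp
  have h4 := Polynomial.Chebyshev.integral_measureT (fun y => f (2 * y))
  rw [Polynomial.Chebyshev.integral_measureT_eq_integral_cos,
    intervalIntegral.integral_of_le (a := -1) (by norm_num)] at h4
  rw [h4, h1, ← integral_const_mul]
  rw [← h3, abs_of_nonneg (by norm_num), smul_eq_mul] at h2
  have h5 : ∫ x, 1 / (Real.pi * √(4 - x ^ 2)) * f x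
      = 2 * ∫ y in Set.Ioc (-1 : ℝ) 1, 1 / (Real.pi * √(4 - (2 * y) ^ 2)) * f (2 * y) := by
    rw [h2]; ring
  rw [h5, ← integral_const_mul]
  congr 1
  funext y
  rw [hsub, Real.sqrt_inv]
  field_simp

theorem integral_semicircleLaw (f : ℝ → ℝ) :
    ∫ x, f x ∂semicircleLaw
      = (2 / Real.pi) * ∫ θ in (0 : ℝ)..Real.pi, f (2 * Real.cos θ) * Real.sin θ ^ 2 := by
  -- The semicircle density is `(4 - x²)/2` times the arcsine density.
  have h1 : ∫ x, f x ∂semicircleLaw = ∫ x, f x * ((4 - x ^ 2) / 2) ∂arcsineLaw := by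
    rw [semicircleLaw, arcsineLaw, integral_withDensity_eq_integral_toReal_smul (by fun_prop)
      (ae_of_all _ fun _ => ENNReal.ofReal_lt_top), integral_withDensity_eq_integral_toReal_smul (by fun_prop)
      (ae_of_all _ fun _ => ENNReal.ofReal_lt_top)]
    refine integral_congr_ae (ae_of_all _ fun x => ?_)
    simp only [smul_eq_mul]
    rw [ENNReal.toReal_ofReal (by positivity), ENNReal.toReal_ofReal (by positivity)]
    rcases le_or_gt (4 - x ^ 2) 0 with h | h
    · simp [Real.sqrt_eq_zero_of_nonpos h]
    · have h' := Real.sqrt_pos.2 h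
      have := Real.sq_sqrt h.le
      field_simp
      rw [this]
  rw [h1, integral_arcsineLaw, ← intervalIntegral.integral_const_mul,
    ← intervalIntegral.integral_const_mul]
  congr 1
  funext θ
  rw [Real.sin_sq]
  ring

/-- After `x = 2 cos θ`, both moments are expressed through `∫ cosⁿ` and `∫ cosⁿ⁺²`, which are
related by the reduction formula with ratio `(n + 1)/(n + 2)`. -/
theorem moment_arcsineLaw (n : ℕ) :
    moment arcsineLaw n = ((n : ℂ) / 2 + 1) * moment semicircleLaw n := by
  have h := integral_cos_pow (a := 0) (b := Real.pi) n
  have hs : ∫ θ in (0 : ℝ)..Real.pi, (2 * Real.cos θ) ^ n * Real.sin θ ^ 2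
      = 2 ^ n * ((∫ θ in (0 : ℝ)..Real.pi, Real.cos θ ^ n)
        - ∫ θ in (0 : ℝ)..Real.pi, Real.cos θ ^ (n + 2)) := by
    rw [← intervalIntegral.integral_sub
      (Continuous.intervalIntegrable (by fun_prop) _ _)
      (Continuous.intervalIntegrable (by fun_prop) _ _), ← intervalIntegral.integral_const_mul]
    congr 1
    funext θ
    rw [Real.sin_sq]
    ring
  have ha : ∫ θ in (0 : ℝ)..Real.pi, (2 * Real.cos θ) ^ n
      = 2 ^ n * ∫ θ in (0 : ℝ)..Real.pi, Real.cos θ ^ n := by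
    rw [← intervalIntegral.integral_const_mul]
    simp [mul_pow]
  have hreal : ∫ x, x ^ n ∂arcsineLaw = ((n : ℝ) / 2 + 1) * ∫ x, x ^ n ∂semicircleLaw := by
    rw [integral_arcsineLaw (fun x => x ^ n), integral_semicircleLaw (fun x => x ^ n), hs, ha, h]
    simp only [Real.sin_pi, Real.sin_zero, mul_zero, sub_zero, zero_div, zero_add]
    have hn : (n : ℝ) + 2 ≠ 0 := by positivity
    field_simp
    ring
  rw [moment, moment, hreal]
  push_cast
  rfl

theorem integral_sin_natCast_mul_mul_sin (k : ℕ) :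
    ∫ θ in (0 : ℝ)..Real.pi, Real.sin (((k + 1 : ℕ) : ℝ) * θ) * Real.sin θ
      = if k = 0 then Real.pi / 2 else 0 := by
  have hcos : ∀ j : ℕ, ∫ θ in (0 : ℝ)..Real.pi, Real.cos ((j : ℝ) * θ)
      = if j = 0 then Real.pi else 0 := by
    intro j
    split_ifs with hj
    · simp [hj]
    · rw [intervalIntegral.integral_comp_mul_left _ (Nat.cast_ne_zero.2 hj)]
      simp [Real.sin_nat_mul_pi]
  have h : ∀ θ : ℝ, Real.sin (((k + 1 : ℕ) : ℝ) * θ) * Real.sin θ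
      = (1 / 2) * (Real.cos ((k : ℝ) * θ) - Real.cos (((k + 2 : ℕ) : ℝ) * θ)) := by
    intro θ
    rw [show (k : ℝ) * θ = ((k + 1 : ℕ) : ℝ) * θ - θ by push_cast; ring,
      show ((k + 2 : ℕ) : ℝ) * θ = ((k + 1 : ℕ) : ℝ) * θ + θ by push_cast; ring,
      Real.cos_sub, Real.cos_add]
    ring
  simp_rw [h]
  rw [intervalIntegral.integral_const_mul, intervalIntegral.integral_sub
      (Continuous.intervalIntegrable (by fun_prop) _ _)
      (Continuous.intervalIntegrable (by fun_prop) _ _), hcos, hcos]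
  split_ifs <;> simp_all
  ring

/-- Integration of complex polynomials against the semicircle law. -/
def semicircleFunctional : Polynomial ℂ →ₗ[ℂ] ℂ :=
  Polynomial.lsum fun n => LinearMap.lsmul ℂ ℂ (moment semicircleLaw n)

theorem semicircleFunctional_X_pow (n : ℕ) :
    semicircleFunctional (Polynomial.X ^ n) = moment semicircleLaw n := by
  simp [semicircleFunctional, Polynomial.lsum_apply, Polynomial.X_pow_eq_monomial]

theorem semicircleFunctional_map_ofReal (p : Polynomial ℝ) :
    semicircleFunctional (p.map (algebraMap ℝ ℂ))
      = (((2 / Real.pi) * ∫ θ in (0 : ℝ)..Real.pi,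
          p.eval (2 * Real.cos θ) * Real.sin θ ^ 2 : ℝ) : ℂ) := by
  induction p using Polynomial.induction_on' with
  | add p q hp hq =>
    rw [Polynomial.map_add, map_add, hp, hq, ← Complex.ofReal_add, ← mul_add,
      ← intervalIntegral.integral_add
      (Continuous.intervalIntegrable (by fun_prop) _ _)
      (Continuous.intervalIntegrable (by fun_prop) _ _)]
    simp [add_mul]
  | monomial n a =>
    rw [← Polynomial.C_mul_X_pow_eq_monomial, Polynomial.map_mul, Polynomial.map_C,
      Polynomial.map_pow, Polynomial.map_X, ← Polynomial.smul_eq_C_mul, map_smul,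
      semicircleFunctional_X_pow, moment, integral_semicircleLaw (fun x => x ^ n)]
    simp only [Polynomial.eval_mul, Polynomial.eval_C, Polynomial.eval_pow, Polynomial.eval_X,
      mul_assoc, intervalIntegral.integral_const_mul]
    simp
    ring

/-- Since `S_k(2 cos θ) sin θ = sin((k + 1)θ)`, this is the orthogonality of sines on `[0, π]`. It
matches the semicircle moments with the Wick description. -/
theorem semicircleFunctional_S (k : ℕ) :
    semicircleFunctional (S ℂ k) = if k = 0 then 1 else 0 := by
  have h := semicircleFunctional_map_ofReal (S ℝ k)
  rw [Polynomial.Chebyshev.map_S] at h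
  have h2 : ∀ θ : ℝ, (S ℝ k).eval (2 * Real.cos θ) * Real.sin θ ^ 2
      = Real.sin (((k + 1 : ℕ) : ℝ) * θ) * Real.sin θ := by
    intro θ
    have := Polynomial.Chebyshev.S_two_mul_real_cos θ (k : ℤ)
    rw [pow_two, ← mul_assoc, this]
    push_cast
    rfl
  simp_rw [h2] at h
  rw [integral_sin_natCast_mul_mul_sin] at h
  rw [h]
  split_ifs
  · have := Real.pi_ne_zero
    rw [Complex.ofReal_eq_one]
    field_simp
  · simp

variable {ι : Type*} [DecidableEq ι]

theorem IsWickLaw.map_ι_pow {J : FreeAlgebra ℂ ι →ₗ[ℂ] ℂ} (h : IsWickLaw J) (i : ι) (n : ℕ) :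
    J (FreeAlgebra.ι ℂ i ^ n) = moment semicircleLaw n := by
  have : J ∘ₗ (Polynomial.aeval (FreeAlgebra.ι ℂ i)).toLinearMap = semicircleFunctional := by
    refine LinearMap.ext_on span_chebyshev_S ?_
    rintro _ ⟨k, rfl⟩
    simp only [LinearMap.comp_apply, AlgHom.toLinearMap_apply]
    rw [semicircleFunctional_S, ← wick_replicate, h]
    simp
  rw [← semicircleFunctional_X_pow, ← this]
  simp

theorem IsSemicircularVar.map_aeval {A : Type*} [Ring A] [Algebra ℂ A] {φ : A →ₗ[ℂ] ℂ} {a : A}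
    (h : IsSemicircularVar φ a) (p : Polynomial ℂ) :
    φ (Polynomial.aeval a p) = semicircleFunctional p := by
  induction p using Polynomial.induction_on' with
  | add p q hp hq => rw [map_add, map_add, map_add, hp, hq]
  | monomial n c =>
    rw [← Polynomial.C_mul_X_pow_eq_monomial, ← Polynomial.smul_eq_C_mul, map_smul, map_smul,
      map_smul, semicircleFunctional_X_pow, map_pow, Polynomial.aeval_X, h n]

/-- A free semicircular family has the law of the standard free semicircular family on the full
Fock space. -/
theorem IsFreeSemicircularFamily.jointLaw_eq {A : Type*} [Ring A] [Algebra ℂ A]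
    {φ : A →ₗ[ℂ] ℂ} {s : ι → A} (h : IsFreeSemicircularFamily φ s) (h1 : φ 1 = 1) :
    jointLaw φ s = freeSemicircularLaw ι := by
  refine IsWickLaw.eq ?_ isWickLaw_freeSemicircularLaw
  refine (freelyIndependent_jointLaw h.free).isWickLaw (by simpa [jointLaw] using h1) fun i k => ?_
  rw [jointLaw, LinearMap.comp_apply, AlgHom.toLinearMap_apply, ← Polynomial.aeval_algHom_apply,
    FreeAlgebra.lift_ι_apply, (h.semicircular i).map_aeval, semicircleFunctional_S,
    if_neg (Nat.succ_ne_zero k)]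

end Moments

/-! ### The matrix model -/

section MatrixModel

/-- The endomorphism of the noncommutative polynomials scaling all variables by `c`. -/
def scaleHom (ι : Type*) (c : ℂ) : FreeAlgebra ℂ ι →ₐ[ℂ] FreeAlgebra ℂ ι :=
  FreeAlgebra.lift ℂ fun i => c • FreeAlgebra.ι ℂ i

theorem jointLaw_smul {A : Type*} [Ring A] [Algebra ℂ A] (φ : A →ₗ[ℂ] ℂ) {ι : Type*}
    (x : ι → A) (c : ℂ) :
    jointLaw φ (c • x) = jointLaw φ x ∘ₗ (scaleHom ι c).toLinearMap := by
  have : FreeAlgebra.lift ℂ (c • x) = (FreeAlgebra.lift ℂ x).comp (scaleHom ι c) := by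
    ext i
    simp [scaleHom]
  rw [jointLaw, this]
  rfl

variable {N m : ℕ}

/-- The index of the semicircular variable at the entries `(i, j)` and `(j, i)`. -/
def entryIndex (i j : Fin N) (k : Fin m) : EntryIndex N m :=
  ⟨(min i j, max i j, k), min_le_max⟩

/-- The unordered pairs `{i, r}` and `{r, j}` share `r`, so they coincide only if `i = j`. This
makes the matrix product of annihilators and creators diagonal. -/
theorem entryIndex_eq_iff (i j r : Fin N) (k l : Fin m) :
    entryIndex i r k = entryIndex r j l ↔ k = l ∧ i = j := by
  simp only [entryIndex, Subtype.mk.injEq, Prod.mk.injEq]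
  constructor
  · rintro ⟨h1, h2, h3⟩
    refine ⟨h3, ?_⟩
    rcases le_total i r with h | h <;> rcases le_total r j with h' | h' <;>
      simp only [min_eq_left, min_eq_right, max_eq_left, max_eq_right, h, h'] at h1 h2 <;> order
  · rintro ⟨rfl, rfl⟩
    exact ⟨min_comm _ _, max_comm _ _, rfl⟩

/-- The standard deviation of the entry `(i, j)`. -/
def entryScale (i j : Fin N) : ℝ := √((1 + if i = j then 1 else 0) / (N : ℝ))

theorem semicircularMatrix_apply {A : Type*} [Ring A] [Algebra ℂ A] (s : EntryIndex N m → A)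
    (k : Fin m) (i j : Fin N) :
    semicircularMatrix s k i j = ((entryScale i j : ℝ) : ℂ) • s (entryIndex i j k) := rfl

/-- The `N` entries of a row contribute `1/N` each, and the doubled variance on the diagonal adds
one further `1/N`. This excess is the whole source of the infinitesimal term. -/
theorem sum_entryScale_mul_entryScale (hN : N ≠ 0) (i : Fin N) :
    ∑ r, entryScale i r * entryScale r i = 1 + 1 / (N : ℝ) := by
  have h : ∀ r, entryScale i r * entryScale r i
      = 1 / (N : ℝ) + if i = r then 1 / (N : ℝ) else 0 := by
    intro r
    rw [entryScale, entryScale]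
    simp only [eq_comm (a := r) (b := i)]
    rw [Real.mul_self_sqrt (by positivity)]
    split_ifs <;> ring
  have hN' : (N : ℝ) ≠ 0 := Nat.cast_ne_zero.2 hN
  simp_rw [h]
  rw [Finset.sum_add_distrib, Finset.sum_ite_eq]
  simp [hN']

/-- The law of the matrices depends only on the joint law of their entries, which allows the given
entries to be exchanged for operators on Fock space. -/
theorem jointLaw_semicircularMatrix {A : Type*} [Ring A] [Algebra ℂ A] (φ : A →ₗ[ℂ] ℂ)
    (s : EntryIndex N m → A) :
    jointLaw (matrixFunctional φ N) (semicircularMatrix s)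
      = jointLaw (matrixFunctional (jointLaw φ s) N)
          (semicircularMatrix (FreeAlgebra.ι ℂ : EntryIndex N m → _)) := by
  have h : FreeAlgebra.lift ℂ (semicircularMatrix s)
      = ((FreeAlgebra.lift ℂ s).mapMatrix).comp
        (FreeAlgebra.lift ℂ (semicircularMatrix (FreeAlgebra.ι ℂ : EntryIndex N m → _))) := by
    ext k i j
    simp only [Function.comp_apply, FreeAlgebra.lift_ι_apply, AlgHom.coe_comp,
      AlgHom.mapMatrix_apply, Matrix.map_apply, semicircularMatrix_apply, map_smul]
  refine LinearMap.ext fun p => ?_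
  simp only [jointLaw, LinearMap.comp_apply, AlgHom.toLinearMap_apply, h, AlgHom.comp_apply,
    matrixFunctional, LinearMap.smul_apply, Matrix.traceLinearMap_apply, Matrix.trace,
    Matrix.diag, AlgHom.mapMatrix_apply, Matrix.map_apply, map_sum]

theorem semicircularMatrix_annihilation_mul_creation (hN : N ≠ 0) (k l : Fin m) :
    semicircularMatrix (N := N) annihilation k * semicircularMatrix creation l
      = if k = l then (1 + 1 / (N : ℂ)) • 1 else 0 := by
  ext i j : 1
  rw [Matrix.mul_apply]
  simp only [semicircularMatrix_apply, smul_mul_smul_comm, annihilation_mul_creation,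
    entryIndex_eq_iff]
  by_cases hkl : k = l
  · by_cases hij : i = j
    · subst hij
      simp only [hkl, and_self, if_true, Matrix.smul_apply, Matrix.one_apply_eq]
      rw [← Finset.sum_smul]
      congr 1
      have h := congrArg Complex.ofReal (sum_entryScale_mul_entryScale hN i)
      push_cast at h
      exact h
    · simp [hkl, hij]
  · simp [hkl]

theorem matrixFunctional_one {A : Type*} [Ring A] [Algebra ℂ A] {φ : A →ₗ[ℂ] ℂ} (h1 : φ 1 = 1)
    (hN : N ≠ 0) : matrixFunctional φ N 1 = 1 := by
  have hN' : (N : ℂ) ≠ 0 := Nat.cast_ne_zero.2 hN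
  simp only [matrixFunctional, LinearMap.smul_apply, LinearMap.comp_apply,
    Matrix.traceLinearMap_apply, Matrix.trace, Matrix.diag, Matrix.one_apply_eq, map_sum, h1]
  simp [hN']

theorem matrixFunctional_eq_zero {A : Type*} [Ring A] [Algebra ℂ A] {φ : A →ₗ[ℂ] ℂ}
    {M : Matrix (Fin N) (Fin N) A} (h : ∀ i, φ (M i i) = 0) : matrixFunctional φ N M = 0 := by
  simp [matrixFunctional, Matrix.trace, h]

theorem matrixFunctional_creation_mul (k : Fin m)
    (Y : Matrix (Fin N) (Fin N) (Module.End ℂ (Fock (EntryIndex N m)))) :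
    matrixFunctional (vacuumState _) N (semicircularMatrix creation k * Y) = 0 := by
  refine matrixFunctional_eq_zero fun i => ?_
  simp [Matrix.mul_apply, semicircularMatrix_apply, vacuumState_creation_mul]

theorem matrixFunctional_mul_annihilation (k : Fin m)
    (Y : Matrix (Fin N) (Fin N) (Module.End ℂ (Fock (EntryIndex N m)))) :
    matrixFunctional (vacuumState _) N (Y * semicircularMatrix annihilation k) = 0 := by
  refine matrixFunctional_eq_zero fun i => ?_
  simp [Matrix.mul_apply, semicircularMatrix_apply, vacuumState_mul_annihilation]

/-- The matrices of a free semicircular family are, with respect to `(1/N) Tr ⊗ φ`, free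
semicircular variables of variance `1 + 1/N`. -/
theorem jointLaw_semicircularMatrix_eq_scale {A : Type*} [Ring A] [Algebra ℂ A] {φ : A →ₗ[ℂ] ℂ}
    {s : EntryIndex N m → A} (hs : IsFreeSemicircularFamily φ s) (h1 : φ 1 = 1) (hN : N ≠ 0) :
    jointLaw (matrixFunctional φ N) (semicircularMatrix s)
      = freeSemicircularLaw (Fin m) ∘ₗ
          (scaleHom (Fin m) (√(1 + 1 / (N : ℝ)) : ℝ)).toLinearMap := by
  rw [jointLaw_semicircularMatrix, hs.jointLaw_eq h1, freeSemicircularLaw,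
    ← jointLaw_semicircularMatrix]
  set c : ℂ := Complex.ofReal √(1 + 1 / (N : ℝ)) with hc
  have hcc : c * c = 1 + 1 / (N : ℂ) := by
    rw [hc, ← Complex.ofReal_mul, Real.mul_self_sqrt (by positivity)]
    simp
  have hc0 : c ≠ 0 := by
    rw [hc, Complex.ofReal_ne_zero]
    positivity
  -- Dividing by `c = √(1 + 1/N)` normalises the relation to `b_k a_l = δ_{kl}`.
  set a : Fin m → Matrix (Fin N) (Fin N) (Module.End ℂ (Fock (EntryIndex N m))) :=
    fun k => c⁻¹ • semicircularMatrix creation k with ha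
  set b : Fin m → Matrix (Fin N) (Fin N) (Module.End ℂ (Fock (EntryIndex N m))) :=
    fun k => c⁻¹ • semicircularMatrix annihilation k with hb
  have hab : semicircularMatrix (creation + annihilation) = c • (a + b) := by
    ext k i j : 3
    simp [ha, hb, semicircularMatrix_apply, smul_smul, hc0]
  have hW : IsWickLaw (jointLaw (matrixFunctional (vacuumState (EntryIndex N m)) N) (a + b)) := by
    refine isWickLaw_of_creation_annihilation ?_ _ (matrixFunctional_one vacuumState_one hN) ?_ ?_
    · intro k l
      rw [ha, hb]
      simp only [smul_mul_smul_comm, semicircularMatrix_annihilation_mul_creation hN, ← hcc]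
      split_ifs
      · rw [smul_smul, show c⁻¹ * c⁻¹ * (c * c) = 1 by field_simp, one_smul]
      · simp
    · intro k Y
      rw [ha, smul_mul_assoc, map_smul, matrixFunctional_creation_mul, smul_zero]
    · intro k Y
      rw [hb, mul_smul_comm, map_smul, matrixFunctional_mul_annihilation, smul_zero]
  rw [hab, jointLaw_smul, hW.eq isWickLaw_freeSemicircularLaw]

end MatrixModel

/-! ### The first order expansion in the variance -/

section Expansion

variable {ι : Type*}

theorem basisFreeMonoid_apply (w : FreeMonoid ι) :
    FreeAlgebra.basisFreeMonoid ℂ ι w = FreeMonoid.lift (FreeAlgebra.ι ℂ) w := by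
  simp [FreeAlgebra.basisFreeMonoid, FreeAlgebra.equivMonoidAlgebraFreeMonoid]

theorem scaleHom_basisFreeMonoid (c : ℂ) (w : FreeMonoid ι) :
    scaleHom ι c (FreeAlgebra.basisFreeMonoid ℂ ι w)
      = c ^ w.length • FreeAlgebra.basisFreeMonoid ℂ ι w := by
  rw [basisFreeMonoid_apply]
  induction w using FreeMonoid.inductionOn' with
  | one => simp
  | of_mul i w ih =>
    rw [map_mul, map_mul, ih, FreeMonoid.lift_eval_of, scaleHom, FreeAlgebra.lift_ι_apply,
      smul_mul_smul_comm, FreeMonoid.length_mul, FreeMonoid.length_of, pow_add, pow_one]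

/-- The linear map multiplying each monomial by half of its degree. -/
def halfDegree (ι : Type*) : FreeAlgebra ℂ ι →ₗ[ℂ] FreeAlgebra ℂ ι :=
  (FreeAlgebra.basisFreeMonoid ℂ ι).constr ℂ fun w =>
    ((w.length : ℂ) / 2) • FreeAlgebra.basisFreeMonoid ℂ ι w

theorem halfDegree_basisFreeMonoid (w : FreeMonoid ι) :
    halfDegree ι (FreeAlgebra.basisFreeMonoid ℂ ι w)
      = ((w.length : ℂ) / 2) • FreeAlgebra.basisFreeMonoid ℂ ι w :=
  Module.Basis.constr_basis _ _ _ _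

theorem halfDegree_ι_pow (i : ι) (n : ℕ) :
    halfDegree ι (FreeAlgebra.ι ℂ i ^ n) = ((n : ℂ) / 2) • FreeAlgebra.ι ℂ i ^ n := by
  have h := halfDegree_basisFreeMonoid (FreeMonoid.of i ^ n)
  have hl : ∀ n : ℕ, (FreeMonoid.of i ^ n).length = n := by
    intro n
    induction n with
    | zero => simp
    | succ n ih => rw [pow_succ, FreeMonoid.length_mul, ih, FreeMonoid.length_of]
  rwa [basisFreeMonoid_apply, map_pow, FreeMonoid.lift_eval_of, hl] at h

theorem hasDerivAt_sqrt_one_add_pow (n : ℕ) :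
    HasDerivAt (fun t : ℝ => ((√(1 + t) : ℝ) : ℂ) ^ n) ((n : ℂ) / 2) 0 := by
  have h : HasDerivAt (fun t : ℝ => √(1 + t)) (1 / 2) 0 := by
    simpa using ((hasDerivAt_id (0 : ℝ)).const_add 1).sqrt (by simp)
  have := h.ofReal_comp.pow n
  refine this.congr_deriv ?_
  simp
  ring

/-- The law of free semicircular variables of variance `1 + t`. -/
def semicircularLawAt (ι : Type*) (t : ℝ) : FreeAlgebra ℂ ι →ₗ[ℂ] ℂ :=
  freeSemicircularLaw ι ∘ₗ (scaleHom ι (√(1 + t) : ℝ)).toLinearMap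

/-- The infinitesimal law of free semicircular variables of variance `1 + t`, at `t = 0`. -/
def infinitesimalSemicircularLaw (ι : Type*) : InfinitesimalLaw ι where
  zeroth := freeSemicircularLaw ι
  first := freeSemicircularLaw ι ∘ₗ halfDegree ι
  zeroth_one := by classical exact isWickLaw_freeSemicircularLaw.map_one
  first_one := by
    rcases isEmpty_or_nonempty ι with h | ⟨⟨i⟩⟩
    · have := halfDegree_basisFreeMonoid (1 : FreeMonoid ι)
      simp only [basisFreeMonoid_apply, map_one] at this
      simp [this]
    · have := halfDegree_ι_pow i 0
      simp only [pow_zero] at this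
      simp [this]

/-- By linearity it suffices to treat monomials, where the dependence on `t` is the scalar factor
`√(1 + t)ⁿ`. -/
theorem hasDerivAt_semicircularLawAt (p : FreeAlgebra ℂ ι) :
    HasDerivAt (fun t : ℝ => semicircularLawAt ι t p)
      ((infinitesimalSemicircularLaw ι).first p) 0 := by
  have hp : p ∈ Submodule.span ℂ (Set.range (FreeAlgebra.basisFreeMonoid ℂ ι)) := by
    rw [Module.Basis.span_eq]; trivial
  induction hp using Submodule.span_induction with
  | mem x hx =>
    obtain ⟨w, rfl⟩ := hx
    simp only [semicircularLawAt, infinitesimalSemicircularLaw, LinearMap.comp_apply,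
      AlgHom.toLinearMap_apply, scaleHom_basisFreeMonoid, halfDegree_basisFreeMonoid, map_smul,
      smul_eq_mul]
    exact (hasDerivAt_sqrt_one_add_pow _).mul_const _
  | zero => simpa using hasDerivAt_const (0 : ℝ) (0 : ℂ)
  | add x y _ _ hx hy => simpa only [map_add] using hx.fun_add hy
  | smul c x _ hx => simpa using hx.const_mul c

theorem semicircularLawAt_zero : semicircularLawAt ι 0 = freeSemicircularLaw ι := by
  have : scaleHom ι 1 = AlgHom.id ℂ _ := by
    ext i
    simp [scaleHom]
  simp [semicircularLawAt, this]

theorem isInfinitesimalLimit_infinitesimalSemicircularLaw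
    {φ : ℕ → FreeAlgebra ℂ ι →ₗ[ℂ] ℂ}
    (h : ∀ᶠ N in atTop, φ N = semicircularLawAt ι (1 / (N : ℝ))) :
    (infinitesimalSemicircularLaw ι).IsInfinitesimalLimit φ := by
  intro p
  have hd := hasDerivAt_semicircularLawAt p
  have ht : Tendsto (fun N : ℕ => 1 / (N : ℝ)) atTop (𝓝 0) := tendsto_one_div_atTop_nhds_zero_nat
  have ht' : Tendsto (fun N : ℕ => 1 / (N : ℝ)) atTop (𝓝[≠] 0) := by
    refine tendsto_nhdsWithin_iff.2 ⟨ht, ?_⟩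
    filter_upwards [eventually_ne_atTop 0] with N hN
    simpa using hN
  constructor
  · have h0 := hd.continuousAt.tendsto.comp ht
    rw [semicircularLawAt_zero] at h0
    refine Tendsto.congr' ?_ h0
    filter_upwards [h] with N hN
    simp [hN]
  · refine Tendsto.congr' ?_ ((hasDerivAt_iff_tendsto_slope_zero.1 hd).comp ht')
    filter_upwards [h] with N hN
    simp only [Function.comp_apply, zero_add, hN, semicircularLawAt_zero]
    rw [Complex.real_smul, div_eq_inv_mul (_ - _)]
    push_cast
    rfl

theorem isLittleO_semicircularLawAt_sub (p : FreeAlgebra ℂ ι) :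
    (fun t : ℝ => semicircularLawAt ι t p - (infinitesimalSemicircularLaw ι).lawAt t p)
      =o[𝓝 0] (fun t : ℝ => t) := by
  have h := hasDerivAt_iff_isLittleO.1 (hasDerivAt_semicircularLawAt p)
  simp only [sub_zero, semicircularLawAt_zero] at h
  refine h.congr_left fun t => ?_
  rw [InfinitesimalLaw.lawAt, LinearMap.add_apply, LinearMap.smul_apply, Complex.real_smul,
    smul_eq_mul, sub_sub]
  rfl

end Expansion

/-! ### Infinitesimal freeness -/

section InfinitesimalFreeness

variable {ι : Type*}

/-- Finite linear combinations of fixed polynomials with bounded coefficients, as `t → 0`. -/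
def boundedCurves (ι : Type*) : Submodule ℂ (ℝ → FreeAlgebra ℂ ι) :=
  Submodule.span ℂ {g | ∃ (c : ℝ → ℂ) (p : FreeAlgebra ℂ ι),
    c =O[𝓝 0] (fun _ => (1 : ℝ)) ∧ g = fun t => c t • p}

/-- Finite linear combinations of fixed polynomials with coefficients `o(t)`, as `t → 0`. -/
def smallCurves (ι : Type*) : Submodule ℂ (ℝ → FreeAlgebra ℂ ι) :=
  Submodule.span ℂ {g | ∃ (c : ℝ → ℂ) (p : FreeAlgebra ℂ ι),
    c =o[𝓝 0] (fun t : ℝ => t) ∧ g = fun t => c t • p}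

theorem boundedCurves_mul_boundedCurves :
    boundedCurves ι * boundedCurves ι ≤ boundedCurves ι := by
  rw [boundedCurves, Submodule.span_mul_span]
  refine Submodule.span_mono ?_
  rintro _ ⟨_, ⟨c, p, hc, rfl⟩, _, ⟨d, q, hd, rfl⟩, rfl⟩
  refine ⟨fun t => c t * d t, p * q, by simpa using hc.mul hd, ?_⟩
  funext t
  simp [smul_smul, mul_comm]

theorem smallCurves_mul_boundedCurves :
    smallCurves ι * boundedCurves ι ≤ smallCurves ι := by
  rw [boundedCurves, smallCurves, Submodule.span_mul_span]
  refine Submodule.span_mono ?_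
  rintro _ ⟨_, ⟨c, p, hc, rfl⟩, _, ⟨d, q, hd, rfl⟩, rfl⟩
  refine ⟨fun t => c t * d t, p * q, by simpa using hc.mul_isBigO hd, ?_⟩
  funext t
  simp [smul_smul, mul_comm]

theorem boundedCurves_mul_smallCurves :
    boundedCurves ι * smallCurves ι ≤ smallCurves ι := by
  rw [boundedCurves, smallCurves, Submodule.span_mul_span]
  refine Submodule.span_mono ?_
  rintro _ ⟨_, ⟨c, p, hc, rfl⟩, _, ⟨d, q, hd, rfl⟩, rfl⟩
  refine ⟨fun t => c t * d t, p * q, by simpa using hc.mul_isLittleO hd, ?_⟩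
  funext t
  simp [smul_smul, mul_comm]

theorem smallCurves_le_boundedCurves : smallCurves ι ≤ boundedCurves ι := by
  refine Submodule.span_mono ?_
  rintro _ ⟨c, p, hc, rfl⟩
  refine ⟨c, p, hc.isBigO.trans ?_, rfl⟩
  exact (continuous_id.tendsto (0 : ℝ)).isBigO_one ℝ

theorem const_mem_boundedCurves (p : FreeAlgebra ℂ ι) : (fun _ => p) ∈ boundedCurves ι :=
  Submodule.subset_span ⟨fun _ => 1, p, isBigO_const_const _ one_ne_zero _, by simp⟩

theorem sub_const_mem_boundedCurves (p : FreeAlgebra ℂ ι) {c : ℝ → ℂ}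
    (hc : c =O[𝓝 0] (fun _ => (1 : ℝ))) :
    (fun t => p - algebraMap ℂ _ (c t)) ∈ boundedCurves ι :=
  Submodule.sub_mem _ (const_mem_boundedCurves p)
    (Submodule.subset_span ⟨c, 1, hc, by simp [Algebra.algebraMap_eq_smul_one]⟩)

/-- Replacing the centring constants by others that differ by `o(t)` changes the product only by
`o(t)`. Boundedness is carried along to control the remaining factors. -/
theorem prod_sub_mem_curves {κ : Type*} {α β : ℝ → FreeAlgebra ℂ ι → ℂ}
    (hα : ∀ p, (fun t => α t p) =O[𝓝 0] (fun _ => (1 : ℝ)))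
    (hβ : ∀ p, (fun t => β t p - α t p) =o[𝓝 0] (fun t : ℝ => t)) :
    ∀ w : List (κ × FreeAlgebra ℂ ι),
      (fun t => (w.map fun x => x.2 - algebraMap ℂ _ (α t x.2)).prod) ∈ boundedCurves ι ∧
      (fun t => (w.map fun x => x.2 - algebraMap ℂ _ (α t x.2)).prod
        - (w.map fun x => x.2 - algebraMap ℂ _ (β t x.2)).prod) ∈ smallCurves ι
  | [] => ⟨by simpa using const_mem_boundedCurves 1, by
      simp only [List.map_nil, sub_self]
      exact (smallCurves ι).zero_mem⟩
  | x :: w => by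
    obtain ⟨h1, h2⟩ := prod_sub_mem_curves hα hβ w
    have hx := sub_const_mem_boundedCurves x.2 (hα x.2)
    have hd : (fun t => algebraMap ℂ (FreeAlgebra ℂ ι) (β t x.2 - α t x.2)) ∈ smallCurves ι :=
      Submodule.subset_span ⟨_, 1, hβ x.2, by simp [Algebra.algebraMap_eq_smul_one, sub_smul]⟩
    have h3 := Submodule.sub_mem _ h1 (smallCurves_le_boundedCurves h2)
    simp only [List.map_cons, List.prod_cons]
    refine ⟨boundedCurves_mul_boundedCurves (Submodule.mul_mem_mul hx h1), ?_⟩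
    -- With `P`, `Q` the tail products centred by `α`, `β`: `(x - α)P - (x - β)Q = (x - α)(P - Q) +
    -- (β - α)Q`.
    convert Submodule.add_mem _ (boundedCurves_mul_smallCurves (Submodule.mul_mem_mul hx h2))
      (smallCurves_mul_boundedCurves (Submodule.mul_mem_mul hd h3)) using 1
    funext t
    simp only [Pi.add_apply, Pi.mul_apply, Pi.sub_apply, map_sub]
    noncomm_ring

theorem isLittleO_apply_of_mem_smallCurves {μ : ℝ → FreeAlgebra ℂ ι →ₗ[ℂ] ℂ}
    (hμ : ∀ p, (fun t => μ t p) =O[𝓝 0] (fun _ => (1 : ℝ))) {g : ℝ → FreeAlgebra ℂ ι}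
    (hg : g ∈ smallCurves ι) : (fun t => μ t (g t)) =o[𝓝 0] (fun t : ℝ => t) := by
  induction hg using Submodule.span_induction with
  | mem x hx =>
    obtain ⟨c, p, hc, rfl⟩ := hx
    simpa using hc.mul_isBigO (hμ p)
  | zero => simp
  | add x y _ _ hx hy => simpa using hx.add hy
  | smul c x _ hx => simpa using hx.const_mul_left c

theorem isLittleO_apply_of_mem_boundedCurves {μ : ℝ → FreeAlgebra ℂ ι →ₗ[ℂ] ℂ}
    (hμ : ∀ p, (fun t => μ t p) =o[𝓝 0] (fun t : ℝ => t)) {g : ℝ → FreeAlgebra ℂ ι}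
    (hg : g ∈ boundedCurves ι) : (fun t => μ t (g t)) =o[𝓝 0] (fun t : ℝ => t) := by
  induction hg using Submodule.span_induction with
  | mem x hx =>
    obtain ⟨c, p, hc, rfl⟩ := hx
    simpa using hc.mul_isLittleO (hμ p)
  | zero => simp
  | add x y _ _ hx hy => simpa using hx.add hy
  | smul c x _ hx => simpa using hx.const_mul_left c

/-- Scaling maps each one-variable subalgebra into itself, so the law of variance `1 + t` inherits
exact freeness from variance `1`. -/
theorem semicircularLawAt_prod_centered (t : ℝ) (w : List (ι × FreeAlgebra ℂ ι)) (hw : w ≠ [])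
    (hm : ∀ x ∈ w, x.2 ∈ Algebra.adjoin ℂ {FreeAlgebra.ι ℂ x.1})
    (hc : w.IsChain (fun x y => x.1 ≠ y.1)) :
    semicircularLawAt ι t
      (w.map fun x => x.2 - algebraMap ℂ _ (semicircularLawAt ι t x.2)).prod = 0 := by
  classical
  set σ := scaleHom ι (√(1 + t) : ℝ)
  set τ := freeSemicircularLaw ι
  have hτ : τ 1 = 1 := isWickLaw_freeSemicircularLaw.map_one
  have hf := (isWickLaw_freeSemicircularLaw (ι := ι)).freelyIndependent
    (w.map fun x => (x.1, σ x.2 - algebraMap ℂ _ (τ (σ x.2)))) (by simpa using hw) ?_ ?_ ?_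
  · change τ (σ _) = 0
    rw [map_list_prod]
    simp only [List.map_map, Function.comp_def, map_sub, AlgHom.commutes] at hf ⊢
    exact hf
  · intro x hx
    obtain ⟨y, hy, rfl⟩ := List.mem_map.1 hx
    refine Subalgebra.sub_mem _ ?_ (Subalgebra.algebraMap_mem _ _)
    have h := Subalgebra.mem_map.2 ⟨_, hm y hy, (rfl : σ y.2 = _)⟩
    rw [AlgHom.map_adjoin, Set.image_singleton] at h
    refine Algebra.adjoin_le (Set.singleton_subset_iff.2 ?_) h
    simp only [σ, scaleHom, FreeAlgebra.lift_ι_apply]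
    exact Subalgebra.smul_mem _ (Algebra.self_mem_adjoin_singleton _ _) _
  · intro x hx
    obtain ⟨y, hy, rfl⟩ := List.mem_map.1 hx
    change τ _ = 0
    rw [map_sub, Algebra.algebraMap_eq_smul_one, map_smul, hτ]
    simp
  · rw [List.isChain_map]
    exact hc

theorem variablesInfinitesimallyFree_infinitesimalSemicircularLaw :
    (infinitesimalSemicircularLaw ι).VariablesInfinitesimallyFree := by
  intro w hw hm hc
  refine IsLittleO.mono ?_ nhdsWithin_le_nhds
  set L := infinitesimalSemicircularLaw ι
  have hsub := isLittleO_semicircularLawAt_sub (ι := ι)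
  have hL : ∀ p, (fun t => L.lawAt t p) =O[𝓝 0] (fun _ => (1 : ℝ)) := by
    intro p
    refine Tendsto.isBigO_one ℝ (c := L.lawAt 0 p) (Continuous.tendsto ?_ 0)
    simp only [InfinitesimalLaw.lawAt, LinearMap.add_apply, LinearMap.smul_apply]
    fun_prop
  obtain ⟨h1, h2⟩ := prod_sub_mem_curves hL hsub w
  have h3 := isLittleO_apply_of_mem_smallCurves (μ := fun t => L.lawAt t) hL h2
  have h4 := isLittleO_apply_of_mem_boundedCurves
    (μ := fun t => semicircularLawAt ι t - L.lawAt t) hsub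
    (Submodule.sub_mem _ h1 (smallCurves_le_boundedCurves h2))
  -- Let `P`, `Q` be the products centred by `μ_t = μ + tμ'` and by the exact law `ν_t`. As `ν_t(Q)
  -- = 0`, one has `μ_t(P) = μ_t(P - Q) - (ν_t - μ_t)(Q)`, and both terms are `o(t)`.
  refine (h3.sub h4).congr_left fun t => ?_
  have h0 := semicircularLawAt_prod_centered t w hw hm hc
  simp only [Pi.sub_apply, sub_sub_cancel, LinearMap.sub_apply, map_sub, h0]
  ring

theorem isSemicircular_restrict_infinitesimalSemicircularLaw (k : ι) :
    ((infinitesimalSemicircularLaw ι).restrict k).IsSemicircular := by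
  classical
  intro n
  have h := (isWickLaw_freeSemicircularLaw (ι := ι)).map_ι_pow k n
  have h' := halfDegree_ι_pow k n
  constructor
  · simpa [InfinitesimalLaw.restrict, infinitesimalSemicircularLaw] using h
  · simp only [InfinitesimalLaw.restrict, infinitesimalSemicircularLaw, LinearMap.comp_apply,
      AlgHom.toLinearMap_apply, map_pow, FreeAlgebra.lift_ι_apply, h', map_smul, h,
      moment_arcsineLaw, smul_eq_mul]
    ring

end InfinitesimalFreeness

end InfFree

end

theorem mainTheorem9 (m : ℕ)
    (A : ℕ → Type*) [∀ N, Ring (A N)] [∀ N, Algebra ℂ (A N)]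
    (ψ : ∀ N, A N →ₗ[ℂ] ℂ) (hψ : ∀ N, ψ N 1 = 1)
    (s : ∀ N, InfFree.EntryIndex N m → A N)
    (hs : ∀ N, InfFree.IsFreeSemicircularFamily (ψ N) (s N)) :
    ∃ L : InfFree.InfinitesimalLaw (Fin m),
      L.IsInfinitesimalLimit (fun N =>
        InfFree.jointLaw (InfFree.matrixFunctional (ψ N) N)
          (fun k : Fin m => InfFree.semicircularMatrix (s N) k)) ∧
      L.VariablesInfinitesimallyFree ∧
      ∀ k : Fin m, (L.restrict k).IsSemicircular := by
  refine ⟨InfFree.infinitesimalSemicircularLaw (Fin m),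
    InfFree.isInfinitesimalLimit_infinitesimalSemicircularLaw ?_,
    InfFree.variablesInfinitesimallyFree_infinitesimalSemicircularLaw,
    InfFree.isSemicircular_restrict_infinitesimalSemicircularLaw⟩
  -- At `N = 0` the normalised trace is zero, so the exact formula is only available from `N = 1`
  -- on.
  filter_upwards [eventually_ne_atTop 0] with N hN
  exact InfFree.jointLaw_semicircularMatrix_eq_scale (hs N) (hψ N) hN
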